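/- Let $n \ge 0$ be an integer. Let $\mathrm{XF}_6^{2n+2}$ be the simple graph on the vertex set $\{1, \ldots, 2n+7\}$ whose edges are $\{1,i\}$ for $2 \le i \le 2n+5$, $\{2,i\}$ for $3 \le i \le 2n+5$, $\{i,i+1\}$ for $2 \le i \le 2n+4$, together with $\{2,2n+6\}$, $\{2n+5,2n+6\}$, $\{1,2n+7\}$ and $\{3,2n+7\}$, and let $G = \mathrm{co\text{-}XF}_6^{2n+2}$ be its complement. Let $K$ be a field of characteristic $2$, let $R = K[x_1,\ldots,x_{2n+7},y_1,\ldots,y_{2n+7}]$, and let $$J_G = \left( x_i y_j - x_j y_i \;:\; \{i,j\} \in E(G) \right) \subset R$$ be the binomial edge ideal of $G$. Then $R/J_G$ is not F-pure. Here a ring $A$ of prime characteristic $p$ is called F-pure if the Frobenius map $F : A \to F_*A$ is a pure map of $A$-modules, i.e. for every $A$-module $M$ the map $M \to M \otimes_A F_*A$, $m \mapsto m \otimes F_*1$, is injective, where $F_*A$ is $A$ regarded as an $A$-module via $r \cdot F_*s = F_*(r^p s)$. -/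

import Mathlib

open scoped TensorProduct

universe u

/-- The `R`-module `F_* R`: the additive group of `R`, on which `r : R` acts as multiplication by
`r ^ p`. -/
def FrobeniusPushforward (R : Type u) (_p : ℕ) : Type u := R

namespace FrobeniusPushforward

variable (R : Type u) [CommRing R] (p : ℕ)

instance : CommRing (FrobeniusPushforward R p) := inferInstanceAs (CommRing R)

/-- The identity map `R → F_* R`, `s ↦ F_* s`, as an isomorphism of rings. -/
def of : R ≃+* FrobeniusPushforward R p := RingEquiv.refl R

variable [Fact p.Prime] [CharP R p]

instance : Module R (FrobeniusPushforward R p) :=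
  Module.compHom (FrobeniusPushforward R p) ((of R p).toRingHom.comp (frobenius R p))

theorem smul_of (r s : R) : r • of R p s = of R p (r ^ p * s) := rfl

/-- The Frobenius map `F : R → F_* R`, `r ↦ F_* (r ^ p)`, as an `R`-linear map. -/
def frob : R →ₗ[R] FrobeniusPushforward R p where
  toFun r := of R p (r ^ p)
  map_add' r s := congrArg (of R p) (map_add (frobenius R p) r s)
  map_smul' r s := congrArg (of R p) (mul_pow r s p)

end FrobeniusPushforward

/-- An `R`-linear map `f : N → N'` is pure if for every `R`-module `M` the induced map
`M ⊗ N → M ⊗ N'` is injective. (Purity is tested by finitely presented modules `M`, so for a ring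
`R : Type u` it suffices to let `M` range over the modules in `Type u`.) -/
def IsPureLinearMap {R : Type u} [CommRing R] {N N' : Type u} [AddCommGroup N] [Module R N]
    [AddCommGroup N'] [Module R N'] (f : N →ₗ[R] N') : Prop :=
  ∀ (M : Type u) [AddCommGroup M] [Module R M], Function.Injective (f.lTensor M)

/-- A ring `R` of prime characteristic `p` is F-pure if the Frobenius map `F : R → F_* R` is a pure
map of `R`-modules. -/
def IsFPure (R : Type u) [CommRing R] (p : ℕ) [Fact p.Prime] [CharP R p] : Prop :=
  IsPureLinearMap (FrobeniusPushforward.frob R p)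

/-- F-purity in the form: for every `R`-module `M` the map `M → M ⊗ F_* R`, `m ↦ m ⊗ F_* 1`, is
injective. -/
theorem isFPure_iff (R : Type u) [CommRing R] (p : ℕ) [Fact p.Prime] [CharP R p] :
    IsFPure R p ↔ ∀ (M : Type u) [AddCommGroup M] [Module R M],
      Function.Injective fun m : M => m ⊗ₜ[R] FrobeniusPushforward.of R p 1 := by
  refine forall_congr' fun M => forall_congr' fun _ => forall_congr' fun _ => ?_
  have h : (fun m : M => m ⊗ₜ[R] FrobeniusPushforward.of R p 1) =
      ((FrobeniusPushforward.frob R p).lTensor M) ∘ (TensorProduct.rid R M).symm := by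
    funext m
    simp [FrobeniusPushforward.frob]
  rw [h, EquivLike.injective_comp]

section BinomialEdgeIdeal

variable {V : Type} (K : Type u) [Field K]

/-- The binomial `f_{i,j} = x_i y_j - x_j y_i` in the polynomial ring `K[x_v, y_v : v ∈ V]`, where
`x_v` is the variable `Sum.inl v` and `y_v` is the variable `Sum.inr v`. -/
noncomputable def edgeBinomial (i j : V) : MvPolynomial (V ⊕ V) K :=
  MvPolynomial.X (Sum.inl i) * MvPolynomial.X (Sum.inr j) -
    MvPolynomial.X (Sum.inl j) * MvPolynomial.X (Sum.inr i)

/-- The binomial edge ideal `J_G`, generated by the `f_{i,j}` for the edges `{i, j}` of `G`. -/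
noncomputable def binomialEdgeIdeal (G : SimpleGraph V) : Ideal (MvPolynomial (V ⊕ V) K) :=
  Ideal.span {f | ∃ i j : V, G.Adj i j ∧ f = edgeBinomial K i j}

/-- The quotient ring `R_G = K[x_v, y_v : v ∈ V] / J_G`. -/
abbrev BinomialEdgeRing (G : SimpleGraph V) : Type u :=
  MvPolynomial (V ⊕ V) K ⧸ binomialEdgeIdeal K G

theorem binomialEdgeIdeal_ne_top (G : SimpleGraph V) : binomialEdgeIdeal K G ≠ ⊤ := by
  have h : binomialEdgeIdeal K G ≤
      RingHom.ker (MvPolynomial.constantCoeff : MvPolynomial (V ⊕ V) K →+* K) := by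
    refine Ideal.span_le.2 ?_
    rintro f ⟨i, j, -, rfl⟩
    simp [edgeBinomial]
  intro htop
  rw [htop, top_le_iff] at h
  exact RingHom.ker_ne_top _ h

instance (G : SimpleGraph V) : Nontrivial (BinomialEdgeRing K G) :=
  Ideal.Quotient.nontrivial_iff.2 (binomialEdgeIdeal_ne_top K G)

instance (G : SimpleGraph V) (p : ℕ) [CharP K p] : CharP (BinomialEdgeRing K G) p :=
  charP_of_injective_algebraMap (algebraMap K (BinomialEdgeRing K G)).injective p

end BinomialEdgeIdeal

/-- The graph `XF_6^{2n+2}` on the vertices `1, …, 2n+7`, with edges `{1,i}` for `2 ≤ i ≤ 2n+5`,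
`{2,i}` for `3 ≤ i ≤ 2n+5`, `{i,i+1}` for `2 ≤ i ≤ 2n+4`, and `{2,2n+6}`, `{2n+5,2n+6}`,
`{1,2n+7}`, `{3,2n+7}`. The vertex `k` is the element `k - 1` of `Fin (2n+7)`. -/
def graphXF6 (n : ℕ) : SimpleGraph (Fin (2 * n + 7)) :=
  SimpleGraph.fromRel fun u v =>
    let a : ℕ := u.val + 1
    let b : ℕ := v.val + 1
    (a = 1 ∧ 2 ≤ b ∧ b ≤ 2 * n + 5) ∨
    (a = 2 ∧ 3 ≤ b ∧ b ≤ 2 * n + 5) ∨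
    (2 ≤ a ∧ a ≤ 2 * n + 4 ∧ b = a + 1) ∨
    (a = 2 ∧ b = 2 * n + 6) ∨
    (a = 2 * n + 5 ∧ b = 2 * n + 6) ∨
    (a = 1 ∧ b = 2 * n + 7) ∨
    (a = 3 ∧ b = 2 * n + 7)

/-- The graph `co-XF_6^{2n+2}`, the complement of `XF_6^{2n+2}`. -/
def graphCoXF6 (n : ℕ) : SimpleGraph (Fin (2 * n + 7)) := (graphXF6 n)ᶜ

/-! F-purity lets linear systems over `A` solvable in `F_* A` be solved in `A`. In characteristic 2
the elements `F_* (x_s y_s x_t y_t)` solve such a system, so `A` contains `W s t` behaving like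
square roots of `x_s y_s x_t y_t`. Let `U a b` be the coefficient of `x_a y_b` in a lift of `W a b`,
for nonadjacent `a`, `b`. Comparing coefficients modulo `J_G` gives `U a b = U c b` and `U b a = U b
c` when `a`, `c` are adjacent and both are nonadjacent to `b`; this is the forcing relation of
transitive orientations of the complement. Moreover `U a b + U b a = 1` when `a ≠ b` also have a
common neighbour. In `XF_6^{2n+2}` the edge from `2n+6` to `0` (zero-based labels) forces its own
reversal, while its ends have a common neighbour in `G`. Hence `1 = 2 * U = 0`. -/

/-! ### Descent of linear systems along Frobenius. -/

section Purity

variable {A : Type u} [CommRing A]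

/-- If `A` is F-pure, then a finite linear system with coefficients and right-hand side in `A` which
has a solution in `F_* A` has a solution in `A`. -/
theorem IsFPure.exists_solution {p : ℕ} [Fact p.Prime] [CharP A p] (hA : IsFPure A p)
    {ι κ : Type*} [Finite ι] [Fintype κ] (C : ι → κ → A) (b : ι → A)
    (ζ : κ → FrobeniusPushforward A p)
    (h : ∀ i, Fintype.linearCombination A ζ (C i) = b i • FrobeniusPushforward.of A p 1) :
    ∃ w : κ → A, ∀ i, Fintype.linearCombination A w (C i) = b i := by
  classical
  have : Fintype ι := Fintype.ofFinite ι
  -- Reindexing keeps the cokernel in `Type u`, where purity is tested.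
  let ι' := ULift.{u} (Fin (Fintype.card ι))
  let e : ι' ≃ ι := Equiv.ulift.trans (Fintype.equivFin ι).symm
  let col : κ → ι' → A := fun j i => C (e i) j
  -- Purity is applied to the cokernel of the system: the class of `b` dies after tensoring with
  -- `F_* A`, hence is already zero.
  let N : Submodule A (ι' → A) := Submodule.span A (Set.range col)
  have hb (v : ι' → A) : v = ∑ i, v i • (Pi.single i (1 : A) : ι' → A) := by
    simpa using (pi_eq_sum_univ' v)
  have hz : N.mkQ (fun i => b (e i)) ⊗ₜ[A] FrobeniusPushforward.of A p 1 = 0 := by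
    rw [hb (fun i => b (e i)), map_sum, TensorProduct.sum_tmul]
    simp_rw [map_smul, TensorProduct.smul_tmul, ← h, Fintype.linearCombination_apply,
      TensorProduct.tmul_sum]
    rw [Finset.sum_comm]
    refine Finset.sum_eq_zero fun j _ => ?_
    simp_rw [← TensorProduct.smul_tmul, ← map_smul]
    rw [← TensorProduct.sum_tmul, ← map_sum]
    have : ∑ i, C (e i) j • (Pi.single i (1 : A) : ι' → A) = col j := (hb (col j)).symm
    rw [this]
    have h0 : N.mkQ (col j) = 0 :=
      (Submodule.Quotient.mk_eq_zero N).2 (Submodule.subset_span ⟨j, rfl⟩)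
    rw [h0, TensorProduct.zero_tmul]
  have hb0 : N.mkQ (fun i => b (e i)) = 0 := by
    refine (isFPure_iff A p).1 hA _ ?_
    simp only [TensorProduct.zero_tmul]
    exact hz
  have hmem : (fun i => b (e i)) ∈ N := (Submodule.Quotient.mk_eq_zero N).1 hb0
  obtain ⟨w, hw⟩ := (Submodule.mem_span_range_iff_exists_fun A).1 hmem
  refine ⟨w, fun i => ?_⟩
  have := congrFun hw (e.symm i)
  simp only [Finset.sum_apply, Pi.smul_apply, smul_eq_mul, Equiv.apply_symm_apply, col] at this
  simpa [Fintype.linearCombination_apply, mul_comm] using this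

end Purity

/-! ### Square roots of `x_s y_s x_t y_t`. -/

section Exchange

variable {A : Type u} [CommRing A] [CharP A 2] {V : Type*} [Finite V]

/-- Solutions in an F-pure ring of characteristic two of the linear system satisfied by the elements
`F_* (x_s y_s x_t y_t)`. -/
theorem IsFPure.exists_exchange (hA : IsFPure A 2) (G : SimpleGraph V) (x y : V → A)
    (hxy : ∀ i j, G.Adj i j → x i * y j = x j * y i) :
    ∃ W : V → V → A,
      (∀ s t c, G.Adj s c → x c * W s t = x s * W c t) ∧
      (∀ s t c, G.Adj s c → y c * W s t = y s * W c t) ∧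
      (∀ s t, W s t = W t s) ∧
      (∀ s t c, G.Adj s c → G.Adj t c → x c * W s t = x s * x t * y c) := by
  classical
  have : Fintype V := Fintype.ofFinite V
  let e : V → V → (V × V → A) := fun s t => Pi.single (s, t) 1
  let T := {q : V × V × V // G.Adj q.1 q.2.2}
  let T' := {q : V × V × V // G.Adj q.1 q.2.2 ∧ G.Adj q.2.1 q.2.2}
  let C : (T ⊕ T) ⊕ ((V × V) ⊕ T') → V × V → A := Sum.elim
    (Sum.elim (fun q => x q.1.2.2 • e q.1.1 q.1.2.1 - x q.1.1 • e q.1.2.2 q.1.2.1)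
      (fun q => y q.1.2.2 • e q.1.1 q.1.2.1 - y q.1.1 • e q.1.2.2 q.1.2.1))
    (Sum.elim (fun q => e q.1 q.2 - e q.2 q.1) (fun q => x q.1.2.2 • e q.1.1 q.1.2.1))
  let b : (T ⊕ T) ⊕ ((V × V) ⊕ T') → A := Sum.elim 0
    (Sum.elim 0 (fun q => x q.1.1 * x q.1.2.1 * y q.1.2.2))
  -- Coefficients act on `F_* A` through their squares. The last family of rows, for instance,
  -- amounts to `x_c² x_s y_s x_t y_t = (x_s x_t y_c)²`, from `x_c y_s = x_s y_c` and `x_c y_t = x_t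
  -- y_c`.
  let ζ : V × V → FrobeniusPushforward A 2 :=
    fun q => FrobeniusPushforward.of A 2 (x q.1 * y q.1 * (x q.2 * y q.2))
  obtain ⟨w, hw⟩ := hA.exists_solution C b ζ (by
    rintro ((⟨⟨s, t, c⟩, h⟩ | ⟨⟨s, t, c⟩, h⟩) | (⟨s, t⟩ | ⟨⟨s, t, c⟩, h, h'⟩)) <;>
    simp only [C, b, e, Sum.elim_inl, Sum.elim_inr, map_sub, map_smul,
      Fintype.linearCombination_apply_single, one_smul, ζ, FrobeniusPushforward.smul_of,
      Pi.zero_apply]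
    all_goals try rw [← map_sub]
    all_goals congr 1
    · linear_combination (x s * x c * (x t * y t)) * hxy c s h.symm
    · linear_combination (y s * y c * (x t * y t)) * hxy s c h
    · ring
    · have h1 := hxy s c h
      have h2 := hxy t c h'
      linear_combination (-(x s * x t * y t * x c)) * h1 - (x s ^ 2 * x t * y c) * h2)
  refine ⟨fun s t => w (s, t), fun s t c h => ?_, fun s t c h => ?_, fun s t => ?_,
    fun s t c h h' => ?_⟩
  · simpa [C, b, e, Fintype.linearCombination_apply_single, sub_eq_zero] using
      hw (Sum.inl (Sum.inl ⟨(s, t, c), h⟩))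
  · simpa [C, b, e, Fintype.linearCombination_apply_single, sub_eq_zero] using
      hw (Sum.inl (Sum.inr ⟨(s, t, c), h⟩))
  · simpa [C, b, e, Fintype.linearCombination_apply_single, sub_eq_zero] using
      hw (Sum.inr (Sum.inl (s, t)))
  · simpa [C, b, e, Fintype.linearCombination_apply_single, sub_eq_zero] using
      hw (Sum.inr (Sum.inr ⟨(s, t, c), h, h'⟩))

end Exchange

/-! ### Coefficient functionals modulo the binomial edge ideal. -/

section Coefficients

open MvPolynomial

variable {V : Type} {K : Type u} [Field K] {G : SimpleGraph V}

theorem monomial_mul_edgeBinomial (s : V ⊕ V →₀ ℕ) (r : K) (i j : V) :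
    monomial s r * edgeBinomial K i j =
      monomial (s + (Finsupp.single (Sum.inl i) 1 + Finsupp.single (Sum.inr j) 1)) r -
      monomial (s + (Finsupp.single (Sum.inl j) 1 + Finsupp.single (Sum.inr i) 1)) r := by
  simp only [edgeBinomial, X, monomial_mul, mul_sub, mul_one]

/-- A linear functional which takes the same value on `m x_i y_j` and `m x_j y_i`, for all edges
`{i, j}` and all terms `m`, vanishes on the binomial edge ideal. -/
theorem eq_zero_of_mem_binomialEdgeIdeal (l : MvPolynomial (V ⊕ V) K →ₗ[K] K)
    (hl : ∀ (s : V ⊕ V →₀ ℕ) (r : K) (i j : V), G.Adj i j →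
      l (monomial (s + (Finsupp.single (Sum.inl i) 1 + Finsupp.single (Sum.inr j) 1)) r) =
      l (monomial (s + (Finsupp.single (Sum.inl j) 1 + Finsupp.single (Sum.inr i) 1)) r))
    {f : MvPolynomial (V ⊕ V) K} (hf : f ∈ binomialEdgeIdeal K G) : l f = 0 := by
  -- `l` is only `K`-linear, so the induction carries an arbitrary multiplier `g`, set to `1` at the
  -- end.
  refine Submodule.span_induction (p := fun f _ => ∀ g, l (g * f) = 0) ?_ (by simp)
    (fun _ _ _ _ h h' g => by rw [mul_add, map_add, h, h', add_zero])
    (fun a f _ h g => by rw [smul_eq_mul, ← mul_assoc, h]) hf 1 |> fun h => by simpa using h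
  rintro _ ⟨i, j, hij, rfl⟩ g
  induction g using MvPolynomial.induction_on' with
  | monomial s r => rw [monomial_mul_edgeBinomial, map_sub, hl s r i j hij, sub_self]
  | add p q hp hq => rw [add_mul, map_add, hp, hq, add_zero]

/-- The exponent of `x_a y_b`. -/
noncomputable def expXY (a b : V) : V ⊕ V →₀ ℕ :=
  Finsupp.single (Sum.inl a) 1 + Finsupp.single (Sum.inr b) 1

/-- No exchange `x_i y_j ↔ x_j y_i` along an edge applies to such a monomial, so it is alone in its
class and its coefficient descends to the quotient. -/
theorem coeff_eq_zero_of_mem {m : V ⊕ V →₀ ℕ}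
    (hm : ∀ i j, G.Adj i j → m (Sum.inl i) = 0 ∨ m (Sum.inr j) = 0)
    {f : MvPolynomial (V ⊕ V) K} (hf : f ∈ binomialEdgeIdeal K G) : coeff m f = 0 := by
  classical
  have key : ∀ (s : V ⊕ V →₀ ℕ) (r : K) (i j : V), G.Adj i j →
      coeff m (monomial (s + (Finsupp.single (Sum.inl i) 1 + Finsupp.single (Sum.inr j) 1)) r) =
        0 := by
    intro s r i j hij
    rw [coeff_monomial, if_neg]
    rintro rfl
    have := hm i j hij
    simp at this
  exact eq_zero_of_mem_binomialEdgeIdeal (lcoeff K m)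
    (fun s r i j hij => (key s r i j hij).trans (key s r j i hij.symm).symm) hf

/-- Both sides are coefficients of the isolated monomial `x_c x_a y_b`, in `x_c f` and in `x_a g`.
-/
theorem coeff_expXY_exchange_left {a b c : V} (hab : ¬ G.Adj a b) (hcb : ¬ G.Adj c b)
    {f g : MvPolynomial (V ⊕ V) K}
    (h : X (Sum.inl c) * f - X (Sum.inl a) * g ∈ binomialEdgeIdeal K G) :
    coeff (expXY a b) f = coeff (expXY c b) g := by
  classical
  have := coeff_eq_zero_of_mem (m := Finsupp.single (Sum.inl c) 1 + expXY a b) (by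
    intro i j hij
    by_contra! hne
    simp only [expXY, Finsupp.add_apply, Finsupp.single_apply, Sum.inl.injEq, Sum.inr.injEq,
      reduceCtorEq, if_false] at hne
    grind) h
  rw [coeff_sub, coeff_X_mul, sub_eq_zero] at this
  rw [this, show Finsupp.single (Sum.inl c) 1 + expXY a b =
    Finsupp.single (Sum.inl a) 1 + expXY c b by simp only [expXY]; abel, coeff_X_mul]

theorem coeff_expXY_exchange_right {a b c : V} (hab : ¬ G.Adj a b) (hcb : ¬ G.Adj c b)
    {f g : MvPolynomial (V ⊕ V) K}
    (h : X (Sum.inr c) * f - X (Sum.inr a) * g ∈ binomialEdgeIdeal K G) :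
    coeff (expXY b a) f = coeff (expXY b c) g := by
  classical
  have := coeff_eq_zero_of_mem (m := Finsupp.single (Sum.inr c) 1 + expXY b a) (by
    intro i j hij
    by_contra! hne
    simp only [expXY, Finsupp.add_apply, Finsupp.single_apply, Sum.inl.injEq, Sum.inr.injEq,
      reduceCtorEq, if_false] at hne
    have := hij.symm
    grind) h
  rw [coeff_sub, coeff_X_mul, sub_eq_zero] at this
  rw [this, show Finsupp.single (Sum.inr c) 1 + expXY b a =
    Finsupp.single (Sum.inr a) 1 + expXY b c by simp only [expXY]; abel, coeff_X_mul]

theorem coeff_expXY_congr {a b : V} (hab : ¬ G.Adj a b) {f g : MvPolynomial (V ⊕ V) K}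
    (h : f - g ∈ binomialEdgeIdeal K G) : coeff (expXY a b) f = coeff (expXY a b) g := by
  classical
  have := coeff_eq_zero_of_mem (m := expXY a b) (by
    intro i j hij
    by_contra! hne
    simp only [expXY, Finsupp.add_apply, Finsupp.single_apply, Sum.inl.injEq, Sum.inr.injEq,
      reduceCtorEq, if_false] at hne
    grind) h
  rwa [coeff_sub, sub_eq_zero] at this

/-- The exponent of `x_a x_b y_c`. -/
noncomputable def expXXY (a b c : V) : V ⊕ V →₀ ℕ :=
  Finsupp.single (Sum.inl a) 1 + expXY b c

theorem expXXY_comm (a b c : V) : expXXY a b c = expXXY b a c := by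
  simp only [expXXY, expXY]; abel

/-- If `x_i y_j` divides `x_a x_b y_c`, then `j = c`, and `i` is one of `a`, `b`. -/
theorem exists_of_add_eq_expXXY {s : V ⊕ V →₀ ℕ} {i j a b c : V}
    (h : s + expXY i j = expXXY a b c) :
    j = c ∧ (i = a ∧ s = Finsupp.single (Sum.inl b) 1 ∨
      i = b ∧ s = Finsupp.single (Sum.inl a) 1) := by
  classical
  have hj := DFunLike.congr_fun h (Sum.inr j)
  have hi := DFunLike.congr_fun h (Sum.inl i)
  simp only [expXXY, expXY, Finsupp.add_apply, Finsupp.single_apply, Sum.inl.injEq, Sum.inr.injEq,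
      reduceCtorEq, if_false, if_true] at hi hj
  have hjc : j = c := by
    by_contra hne
    rw [if_neg (Ne.symm hne)] at hj
    omega
  subst hjc
  refine ⟨rfl, ?_⟩
  by_cases hia : i = a
  · subst hia
    refine Or.inl ⟨rfl, add_right_cancel (b := expXY i j) ?_⟩
    rw [h, expXXY_comm, expXXY]
  · have hib : i = b := by
      by_contra hne
      rw [if_neg (Ne.symm hne), if_neg (Ne.symm hia)] at hi
      omega
    subst hib
    refine Or.inr ⟨rfl, add_right_cancel (b := expXY i j) ?_⟩
    rw [h, expXXY]

/-- The monomials `x_a x_b y_c`, `x_c x_a y_b`, `x_c x_b y_a` form a set closed under exchange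
because `a`, `b` are nonadjacent, so the sum of their coefficients vanishes on the ideal. -/
theorem coeff_expXY_add_coeff_expXY {a b c : V} (hac : G.Adj a c) (hbc : G.Adj b c)
    (hab : ¬ G.Adj a b) (hne : a ≠ b) {f : MvPolynomial (V ⊕ V) K}
    (h : X (Sum.inl c) * f - X (Sum.inl a) * X (Sum.inl b) * X (Sum.inr c) ∈
      binomialEdgeIdeal K G) :
    coeff (expXY a b) f + coeff (expXY b a) f = 1 := by
  classical
  have hm1 : expXXY c a b ≠ expXXY c b a := by
    intro h
    have := DFunLike.congr_fun h (Sum.inr b)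
    simp [expXXY, expXY, hne] at this
  have hca := hac.ne'
  have hcb := hbc.ne'
  have hm2 : expXXY a b c ≠ expXXY c b a := by
    intro h
    have := DFunLike.congr_fun h (Sum.inr c)
    simp [expXXY, expXY, hca.symm] at this
  have hm3 : expXXY a b c ≠ expXXY c a b := by
    intro h
    have := DFunLike.congr_fun h (Sum.inr c)
    simp [expXXY, expXY, hcb.symm] at this
  have key : ∀ (s : V ⊕ V →₀ ℕ) (i j : V), G.Adj i j →
      (s + expXY i j = expXXY a b c ∨ s + expXY i j = expXXY c a b ∨
        s + expXY i j = expXXY c b a) →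
      (s + expXY j i = expXXY a b c ∨ s + expXY j i = expXXY c a b ∨
        s + expXY j i = expXXY c b a) := by
    rintro s i j hij (h | h | h)
    · obtain ⟨rfl, ⟨rfl, rfl⟩ | ⟨rfl, rfl⟩⟩ := exists_of_add_eq_expXXY h
      · right; right; rw [expXXY_comm]; rfl
      · right; left; rw [expXXY_comm]; rfl
    · obtain ⟨rfl, ⟨rfl, rfl⟩ | ⟨rfl, rfl⟩⟩ := exists_of_add_eq_expXXY h
      · left; rfl
      · exact absurd hij hab
    · obtain ⟨rfl, ⟨rfl, rfl⟩ | ⟨rfl, rfl⟩⟩ := exists_of_add_eq_expXXY h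
      · left; rw [expXXY_comm]; rfl
      · exact absurd hij.symm hab
  have hcoeff (m : V ⊕ V →₀ ℕ) (r : K) :
      (lcoeff K (expXXY a b c) + lcoeff K (expXXY c a b) + lcoeff K (expXXY c b a) :
        MvPolynomial (V ⊕ V) K →ₗ[K] K) (monomial m r) =
      if m = expXXY a b c ∨ m = expXXY c a b ∨ m = expXXY c b a then r else 0 := by
    simp only [LinearMap.add_apply, lcoeff_apply, coeff_monomial]
    grind
  have h0 := eq_zero_of_mem_binomialEdgeIdeal
    (lcoeff K (expXXY a b c) + lcoeff K (expXXY c a b) + lcoeff K (expXXY c b a)) (by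
      intro s r i j hij
      refine (hcoeff (s + expXY i j) r).trans (Eq.trans ?_ (hcoeff (s + expXY j i) r).symm)
      exact if_congr ⟨key s i j hij, key s j i hij.symm⟩ rfl rfl) h
  have hX : X (Sum.inl a) * X (Sum.inl b) * X (Sum.inr c) =
      (monomial (expXXY a b c) 1 : MvPolynomial (V ⊕ V) K) := by
    simp only [X, monomial_mul, expXXY, expXY, mul_one, add_assoc]
  rw [map_sub, hX, hcoeff, if_pos (Or.inl rfl), sub_eq_zero] at h0
  -- `x_c` does not divide `x_a x_b y_c`, so only the other two monomials contribute for `x_c f`.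
  have hz : coeff (expXXY a b c) (X (Sum.inl c) * f) = 0 := by
    rw [coeff_X_mul', if_neg]
    simp [expXXY, expXY, hca.symm, hcb.symm]
  rw [LinearMap.add_apply, LinearMap.add_apply, lcoeff_apply, lcoeff_apply, lcoeff_apply, hz,
    zero_add] at h0
  simpa only [expXXY, coeff_X_mul] using h0

end Coefficients

/-- If `K[x, y] / J_G` is F-pure in characteristic two, then the ordered pairs of distinct
nonadjacent vertices carry a function which is constant along the forcing relation of the
complement of `G`, and whose values on the two orientations of a pair with a common neighbour
add up to one. -/
theorem IsFPure.exists_orientation {V : Type} [Finite V] {K : Type u} [Field K] [CharP K 2]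
    {G : SimpleGraph V} (hG : IsFPure (BinomialEdgeRing K G) 2) :
    ∃ U : V → V → K,
      (∀ a b c, G.Adj a c → ¬ G.Adj a b → ¬ G.Adj c b → U a b = U c b ∧ U b a = U b c) ∧
      (∀ a b c, G.Adj a c → G.Adj b c → ¬ G.Adj a b → a ≠ b → U a b + U b a = 1) := by
  let π : MvPolynomial (V ⊕ V) K →+* BinomialEdgeRing K G :=
    Ideal.Quotient.mk (binomialEdgeIdeal K G)
  obtain ⟨W, hx, hy, hs, h1⟩ := hG.exists_exchange G
    (fun i => π (MvPolynomial.X (Sum.inl i))) (fun i => π (MvPolynomial.X (Sum.inr i))) (by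
      intro i j hij
      rw [← map_mul, ← map_mul]
      exact Ideal.Quotient.eq.2 (Ideal.subset_span ⟨i, j, hij, rfl⟩))
  have hπ : ∀ s t, ∃ w, π w = W s t := fun s t => Ideal.Quotient.mk_surjective _
  choose w hw using hπ
  simp only [← hw, ← map_mul] at hx hy hs h1
  have hsymm : ∀ a b, ¬ G.Adj a b →
      MvPolynomial.coeff (expXY a b) (w a b) = MvPolynomial.coeff (expXY a b) (w b a) :=
    fun a b hab => coeff_expXY_congr hab (Ideal.Quotient.eq.1 (hs a b))
  refine ⟨fun a b => MvPolynomial.coeff (expXY a b) (w a b), ?_, ?_⟩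
  · intro a b c hac hab hcb
    refine ⟨coeff_expXY_exchange_left hab hcb (Ideal.Quotient.eq.1 (hx a b c hac)), ?_⟩
    dsimp only
    rw [hsymm b a (fun h => hab h.symm), hsymm b c (fun h => hcb h.symm)]
    exact coeff_expXY_exchange_right hab hcb (Ideal.Quotient.eq.1 (hy a b c hac))
  · intro a b c hac hbc hab hne
    dsimp only
    rw [hsymm b a (fun h => hab h.symm)]
    exact coeff_expXY_add_coeff_expXY hac hbc hab hne (Ideal.Quotient.eq.1 (h1 a b c hac hbc))

/-! ### A self-reversing forcing chain in `XF_6^{2n+2}`. -/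

theorem graphCoXF6_adj {n i j : ℕ} (hi : i < 2 * n + 7) (hj : j < 2 * n + 7)
    (h : 2 ≤ i ∧ i + 2 ≤ j ∧ (i ≠ 2 ∨ j ≠ 2 * n + 6) ∨ i = 0 ∧ j = 2 * n + 5 ∨
      i = 1 ∧ j = 2 * n + 6 ∨ i = 2 * n + 5 ∧ j = 2 * n + 6) :
    (graphCoXF6 n).Adj ⟨i, hi⟩ ⟨j, hj⟩ := by
  simp only [graphCoXF6, graphXF6, SimpleGraph.compl_adj, SimpleGraph.fromRel_adj, ne_eq,
    Fin.mk.injEq]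
  refine ⟨by omega, ?_⟩
  rintro ⟨-, (h | h | h | h | h | h | h) | (h | h | h | h | h | h | h)⟩ <;> omega

theorem not_graphCoXF6_adj {n i j : ℕ} (hi : i < 2 * n + 7) (hj : j < 2 * n + 7)
    (hij : i ≠ j) (h : i = 0 ∧ 1 ≤ j ∧ j ≤ 2 * n + 4 ∨ i = 1 ∧ 2 ≤ j ∧ j ≤ 2 * n + 5 ∨
      1 ≤ i ∧ j = i + 1 ∧ j ≤ 2 * n + 5 ∨ (i = 0 ∨ i = 2) ∧ j = 2 * n + 6) :
    ¬ (graphCoXF6 n).Adj ⟨i, hi⟩ ⟨j, hj⟩ := by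
  simp only [graphCoXF6, SimpleGraph.compl_adj, not_and, not_not]
  intro _
  simp only [graphXF6, SimpleGraph.fromRel_adj, ne_eq, Fin.mk.injEq]
  refine ⟨hij, Or.inl ?_⟩
  rcases h with h | h | h | ⟨h | h, h'⟩
  · exact Or.inl (by omega)
  · by_cases hj' : j = 2 * n + 5
    · exact Or.inr (Or.inr (Or.inr (Or.inl (by omega))))
    · exact Or.inr (Or.inl (by omega))
  · by_cases hj' : j = 2 * n + 5
    · exact Or.inr (Or.inr (Or.inr (Or.inr (Or.inl (by omega)))))
    · exact Or.inr (Or.inr (Or.inl (by omega)))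
  · exact Or.inr (Or.inr (Or.inr (Or.inr (Or.inr (Or.inl (by omega))))))
  · exact Or.inr (Or.inr (Or.inr (Or.inr (Or.inr (Or.inr (by omega))))))

theorem mainTheorem8 (K : Type u) [Field K] [CharP K 2] (n : ℕ) :
    ¬ IsFPure (BinomialEdgeRing K (graphCoXF6 n)) 2 := by
  intro hF
  obtain ⟨U, hU, hU1⟩ := hF.exists_orientation
  let v (k : ℕ) (hk : k < 2 * n + 7 := by omega) : Fin (2 * n + 7) := ⟨k, hk⟩
  have hadj (i j : ℕ) (hi : i < 2 * n + 7 := by omega) (hj : j < 2 * n + 7 := by omega)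
      (h : 2 ≤ i ∧ i + 2 ≤ j ∧ (i ≠ 2 ∨ j ≠ 2 * n + 6) ∨ i = 0 ∧ j = 2 * n + 5 ∨
        i = 1 ∧ j = 2 * n + 6 ∨ i = 2 * n + 5 ∧ j = 2 * n + 6 := by omega) : (graphCoXF6 n).Adj (v i) (v j) :=
    graphCoXF6_adj hi hj h
  have hnadj (i j : ℕ) (hi : i < 2 * n + 7 := by omega) (hj : j < 2 * n + 7 := by omega)
      (hij : i ≠ j := by omega)
      (h : i = 0 ∧ 1 ≤ j ∧ j ≤ 2 * n + 4 ∨ i = 1 ∧ 2 ≤ j ∧ j ≤ 2 * n + 5 ∨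
        1 ≤ i ∧ j = i + 1 ∧ j ≤ 2 * n + 5 ∨ (i = 0 ∨ i = 2) ∧ j = 2 * n + 6 := by omega) :
      ¬ (graphCoXF6 n).Adj (v i) (v j) := not_graphCoXF6_adj hi hj hij h
  have hnadj' (i j : ℕ) (hi : i < 2 * n + 7 := by omega) (hj : j < 2 * n + 7 := by omega)
      (hij : i ≠ j := by omega)
      (h : i = 0 ∧ 1 ≤ j ∧ j ≤ 2 * n + 4 ∨ i = 1 ∧ 2 ≤ j ∧ j ≤ 2 * n + 5 ∨
        1 ≤ i ∧ j = i + 1 ∧ j ≤ 2 * n + 5 ∨ (i = 0 ∨ i = 2) ∧ j = 2 * n + 6 := by omega) :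
      ¬ (graphCoXF6 n).Adj (v j) (v i) := fun hji => hnadj i j hi hj hij h hji.symm
  -- The forcing chain walks along the path of `XF_6^{2n+2}`, moving the two ends alternately. Each
  -- pass advances both by two, so the odd vertex always stays in the first place.
  have hpath (j : ℕ) (hj : j ≤ n) :
      U (v (2 * n + 6)) (v 0) = U (v (2 * j + 3)) (v (2 * j + 4)) := by
    induction j with
    | zero =>
      calc U (v (2 * n + 6)) (v 0)
        _ = U (v 1) (v 0) :=
          (hU _ _ _ (hadj 1 (2 * n + 6)).symm (hnadj' 0 (2 * n + 6)) (hnadj' 0 1)).1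
        _ = U (v 1) (v (2 * n + 5)) :=
          (hU _ _ _ (hadj 0 (2 * n + 5)) (hnadj 0 1) (hnadj' 1 (2 * n + 5))).2
        _ = U (v 1) (v 2) :=
          (hU _ _ _ (hadj 2 (2 * n + 5)).symm (hnadj' 1 (2 * n + 5)) (hnadj' 1 2)).2
        _ = U (v (2 * n + 6)) (v 2) :=
          (hU _ _ _ (hadj 1 (2 * n + 6)) (hnadj 1 2) (hnadj' 2 (2 * n + 6))).1
        _ = U (v 3) (v 2) :=
          (hU _ _ _ (hadj 3 (2 * n + 6)).symm (hnadj' 2 (2 * n + 6)) (hnadj' 2 3)).1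
        _ = U (v 3) (v 4) := (hU _ _ _ (hadj 2 4) (hnadj 2 3) (hnadj' 3 4)).2
    | succ j ih =>
      calc U (v (2 * n + 6)) (v 0)
        _ = U (v (2 * j + 3)) (v (2 * j + 4)) := ih (by omega)
        _ = U (v (2 * j + 5)) (v (2 * j + 4)) :=
          (hU _ _ _ (hadj (2 * j + 3) (2 * j + 5)) (hnadj (2 * j + 3) (2 * j + 4))
            (hnadj' (2 * j + 4) (2 * j + 5))).1
        _ = U (v (2 * j + 5)) (v (2 * j + 6)) :=
          (hU _ _ _ (hadj (2 * j + 4) (2 * j + 6)) (hnadj (2 * j + 4) (2 * j + 5))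
            (hnadj' (2 * j + 5) (2 * j + 6))).2
  -- By parity the chain reaches the last odd vertex `2n+5` in the first place; its neighbour `0` in
  -- `G` replaces it there, which reverses the edge.
  have hsymm : U (v (2 * n + 6)) (v 0) = U (v 0) (v (2 * n + 6)) := by
    calc U (v (2 * n + 6)) (v 0)
      _ = U (v (2 * n + 3)) (v (2 * n + 4)) := hpath n le_rfl
      _ = U (v (2 * n + 5)) (v (2 * n + 4)) :=
        (hU _ _ _ (hadj (2 * n + 3) (2 * n + 5)) (hnadj (2 * n + 3) (2 * n + 4))
          (hnadj' (2 * n + 4) (2 * n + 5))).1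
      _ = U (v 0) (v (2 * n + 4)) :=
        (hU _ _ _ (hadj 0 (2 * n + 5)).symm (hnadj' (2 * n + 4) (2 * n + 5))
          (hnadj 0 (2 * n + 4))).1
      _ = U (v 0) (v (2 * n + 6)) :=
        (hU _ _ _ (hadj (2 * n + 4) (2 * n + 6)) (hnadj' 0 (2 * n + 4))
          (hnadj' 0 (2 * n + 6))).2
  have hsum : U (v (2 * n + 6)) (v 0) + U (v 0) (v (2 * n + 6)) = 1 :=
    hU1 _ _ (v (2 * n + 5)) (hadj (2 * n + 5) (2 * n + 6)).symm (hadj 0 (2 * n + 5))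
      (hnadj' 0 (2 * n + 6)) (by simp [v])
  rw [hsymm, CharTwo.add_self_eq_zero] at hsum
  exact zero_ne_one hsum
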